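/- Let $r\ge 2$ be an integer and let $H=(V,E)$ be an $r$-uniform hypergraph on a finite nonempty vertex set $V$ (so $E$ is a set of $r$-element subsets of $V$), with $m=|E|$ edges. Let $$\rho_1(H)=\max\Big\{\, r\sum_{e\in E}\prod_{i\in e}x_i \;:\; x\in\mathbb{R}^V,\ x_i\ge 0 \text{ for all } i,\ \sum_{i\in V}x_i=1\Big\}$$ be its $1$-spectral radius and $\mu(H)=\tfrac1r\rho_1(H)$ its Lagrangian. Let $s\ge r-1$ be the real number with $m=\binom{s}{r}:=\frac{s(s-1)\cdots(s-r+1)}{r!}$. Then $$\mu(H)\le m\,s^{-r}.$$ Moreover, if $|V|\ge r-1$ (which is automatic when $m\ge 1$), equality holds if and only if $s$ is an integer and $H$ is the complete $r$-uniform hypergraph $K_s^r$ possibly with some isolated vertices added, that is, $E$ is the set of all $r$-element subsets of some $s$-element subset of $V$. -/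

import Mathlib

open scoped ENNReal

/-- An `r`-uniform hypergraph with vertex set `V`: its edges are `r`-element subsets of `V`. -/
@[ext]
structure UniformHypergraph (V : Type*) (r : ℕ) where
  /-- the set of edges -/
  edges : Finset (Finset V)
  /-- every edge has exactly `r` vertices -/
  card_of_mem : ∀ e ∈ edges, e.card = r

namespace UniformHypergraph

variable {V : Type*} {r : ℕ}

/-- The polynomial form `P_H(x) = r * ∑_{e ∈ E(H)} ∏_{i ∈ e} x_i`. -/
def polyForm (H : UniformHypergraph V r) (x : V → ℝ) : ℝ :=
  (r : ℝ) * ∑ e ∈ H.edges, ∏ i ∈ e, x i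

/-- The set `S_p^+` of nonnegative vectors whose `p`-norm is `1`. -/
def nonnegSphere (V : Type*) [Fintype V] (p : ℝ≥0∞) : Set (V → ℝ) :=
  {x | (∀ i, 0 ≤ x i) ∧ ‖WithLp.toLp p x‖ = 1}

/-- The `p`-spectral radius `ρ_p(H)`: the maximum of `P_H` on `S_p^+`. -/
noncomputable def pSpectralRadius [Fintype V] (H : UniformHypergraph V r) (p : ℝ≥0∞) : ℝ :=
  sSup (H.polyForm '' nonnegSphere V p)

/-- The Lagrangian `μ(H) = ρ_1(H) / r`. -/
noncomputable def lagrangian [Fintype V] (H : UniformHypergraph V r) : ℝ :=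
  H.pSpectralRadius 1 / r

/-- `H` is the complete `r`-uniform hypergraph on `k` vertices, possibly with some isolated
vertices added: for some set `S` of `k` vertices, the edges are exactly the `r`-subsets of `S`
(so that the vertices outside `S` are isolated). -/
def IsCompleteWithIsolated (H : UniformHypergraph V r) (k : ℕ) : Prop :=
  ∃ S : Finset V, S.card = k ∧ H.edges = S.powersetCard r

/-- On a nonempty vertex set the supremum in the definition of `ρ_p(H)` is a maximum. -/
theorem isGreatest_pSpectralRadius [Fintype V] [Nonempty V] (H : UniformHypergraph V r)
    (p : ℝ≥0∞) [Fact (1 ≤ p)] :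
    IsGreatest (H.polyForm '' nonnegSphere V p) (H.pSpectralRadius p) := by
  classical
  have hcont : Continuous H.polyForm := by
    unfold polyForm
    fun_prop
  have hcomp : IsCompact (nonnegSphere V p) := by
    have h1 : IsCompact ((WithLp.ofLp : PiLp p (fun _ : V => ℝ) → V → ℝ) ''
        Metric.sphere 0 1) :=
      (isCompact_sphere _ _).image (PiLp.continuous_ofLp p _)
    have h2 : IsClosed {x : V → ℝ | ∀ i, 0 ≤ x i} := by
      simp only [Set.ofPred_forall]
      exact isClosed_iInter fun i => isClosed_le continuous_const (continuous_apply i)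
    convert h1.inter_left h2 using 1
    ext x
    constructor
    · rintro ⟨h, h'⟩
      exact ⟨h, WithLp.toLp p x, by simpa using h', rfl⟩
    · rintro ⟨h, y, hy, rfl⟩
      exact ⟨h, by simpa using hy⟩
  have hne : (nonnegSphere V p).Nonempty := by
    obtain ⟨v⟩ := ‹Nonempty V›
    refine ⟨Pi.single v 1, fun i => ?_, ?_⟩
    · by_cases h : i = v
      · subst h; simp
      · simp [h]
    · simp
  exact (hcomp.image hcont).isGreatest_sSup (hne.image _)

end UniformHypergraph

/-! The proof is by entropy. Take a maximiser x with value P > 0, draw an edge e with probability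
∏_{i ∈ e} x_i / P and order it uniformly at random. Let S_k be the entropy of the first k entries
and a_k = exp(S_{k+1} - S_k). Three facts carry the bound. (1) ∏_{k<r} a_k = exp S_r ≤ r! m, since
there are r! m ordered edges. (2) r! P a_0^r ≤ ∏_{k<r} a_k: S_r is explicit in terms of log x, and
Gibbs' inequality compares the law of one vertex with x (`log_add_mul_entropy_le`). (3) a_{k+1} + 1
≤ a_k: the next two entries are exchangeable and distinct, and allowing them to coincide adds one
"choice" (`one_add_exp_entropy_sub_le_of_exchangeable`). So a_k ≤ a_0 - k, and r! P ≤ ∏ a_k / a_0^r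
≤ ∏ (s - k) / s^r = r! m / s^r (`prod_div_pow_le`). Equality forces a_0 = s and a_1 + 1 = a_0. The
equality case of Gibbs then makes one vertex uniform on a set of exactly s vertices; every edge lies
in that set, and m = binom(s, r) leaves no edge out. -/

open Real in
/-- The Shannon entropy of a weight function on a finite type. -/
noncomputable def entropy {α : Type*} [Fintype α] (f : α → ℝ) : ℝ :=
  ∑ a, negMulLog (f a)

/-! ### Gibbs' inequality and its equality case -/

/-- This is log t ≤ t - 1 at t = b / a. Absolute continuity `hab` is needed because `Real.log 0 =
0`. -/
theorem mul_log_sub_log_le {a b : ℝ} (ha : 0 ≤ a) (hb : 0 ≤ b) (hab : b = 0 → a = 0) :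
    a * (Real.log b - Real.log a) ≤ b - a := by
  rcases ha.eq_or_lt with rfl | ha
  · simpa using hb
  have hb : 0 < b := hb.lt_of_ne fun h => ha.ne' (hab h.symm)
  rw [← Real.log_div hb.ne' ha.ne']
  calc a * Real.log (b / a) ≤ a * (b / a - 1) :=
        mul_le_mul_of_nonneg_left (Real.log_le_sub_one_of_pos (by positivity)) ha.le
    _ = b - a := by field_simp

theorem eq_of_mul_log_sub_log_eq {a b : ℝ} (ha : 0 ≤ a) (hb : 0 ≤ b) (hab : b = 0 → a = 0)
    (h : a * (Real.log b - Real.log a) = b - a) : a = b := by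
  rcases ha.eq_or_lt with rfl | ha
  · simpa using h
  have hb : 0 < b := hb.lt_of_ne fun h => ha.ne' (hab h.symm)
  by_contra hne
  have h1 : b / a ≠ 1 := fun h' => hne ((div_eq_one_iff_eq ha.ne').1 h').symm
  have h2 := mul_lt_mul_of_pos_left (Real.log_lt_sub_one_of_pos (by positivity) h1) ha
  rw [Real.log_div hb.ne' ha.ne', h] at h2
  have h3 : a * (b / a - 1) = b - a := by field_simp
  linarith

section Gibbs

variable {ι : Type*} [Fintype ι] {p q : ι → ℝ}

/-- Gibbs' inequality. -/
theorem sum_mul_log_sub_log_nonpos (hp : ∀ i, 0 ≤ p i) (hq : ∀ i, 0 ≤ q i)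
    (hpq : ∀ i, q i = 0 → p i = 0) (hsum : ∑ i, q i ≤ ∑ i, p i) :
    ∑ i, p i * (Real.log (q i) - Real.log (p i)) ≤ 0 := by
  have h : ∑ i, p i * (Real.log (q i) - Real.log (p i)) ≤ ∑ i, (q i - p i) :=
    Finset.sum_le_sum fun i _ => mul_log_sub_log_le (hp i) (hq i) (hpq i)
  rw [Finset.sum_sub_distrib] at h
  linarith

/-- The equality case of Gibbs' inequality. -/
theorem eq_of_sum_mul_log_sub_log_eq_zero (hp : ∀ i, 0 ≤ p i) (hq : ∀ i, 0 ≤ q i)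
    (hpq : ∀ i, q i = 0 → p i = 0) (hsum : ∑ i, q i ≤ ∑ i, p i)
    (h : ∑ i, p i * (Real.log (q i) - Real.log (p i)) = 0) (i : ι) : p i = q i := by
  have hle : ∀ i ∈ Finset.univ, p i * (Real.log (q i) - Real.log (p i)) ≤ q i - p i :=
    fun i _ => mul_log_sub_log_le (hp i) (hq i) (hpq i)
  have h2 : ∑ i, p i * (Real.log (q i) - Real.log (p i)) = ∑ i, (q i - p i) := by
    refine le_antisymm (Finset.sum_le_sum hle) ?_
    rw [h, Finset.sum_sub_distrib]
    linarith
  exact eq_of_mul_log_sub_log_eq (hp i) (hq i) (hpq i)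
    ((Finset.sum_eq_sum_iff_of_le hle).1 h2 i (Finset.mem_univ i))

end Gibbs

theorem entropy_eq_neg_sum {α : Type*} [Fintype α] (f : α → ℝ) :
    entropy f = -∑ a, f a * Real.log (f a) := by
  simp [entropy, Real.negMulLog]

/-- Gibbs' inequality against the uniform law on `s`. -/
theorem entropy_le_log_card {α : Type*} [Fintype α] {f : α → ℝ} (hf : ∀ a, 0 ≤ f a)
    (hsum : ∑ a, f a = 1) {s : Finset α} (hs : ∀ a, a ∉ s → f a = 0) :
    entropy f ≤ Real.log s.card := by
  classical
  have hcard : (0 : ℝ) < s.card := by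
    rw [Nat.cast_pos, Finset.card_pos, Finset.nonempty_iff_ne_empty]
    rintro rfl
    simp [hs] at hsum
  have h := sum_mul_log_sub_log_nonpos (p := f) (q := fun a => if a ∈ s then (s.card : ℝ)⁻¹ else 0)
    hf (fun a => by positivity) (fun a ha => hs a fun h => by simp [h] at ha; simp [ha] at h)
    (by rw [hsum, ← Finset.sum_filter]; simp [hcard.ne'])
  have h2 : ∀ a, f a * (Real.log (if a ∈ s then (s.card : ℝ)⁻¹ else 0) - Real.log (f a)) =
      -(f a * Real.log s.card) - f a * Real.log (f a) := by
    intro a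
    by_cases ha : a ∈ s
    · simp [ha]; ring
    · simp [hs a ha]
  rw [entropy_eq_neg_sum]
  simp only [h2, Finset.sum_sub_distrib, Finset.sum_neg_distrib, ← Finset.sum_mul, hsum] at h
  linarith

/-! ### The entropy inequality for exchangeable pairs -/

section Exchangeable

variable {C V : Type*} [Fintype C] [Fintype V] {p : C → V → V → ℝ} {p₁ : C → V → ℝ} {p₀ : C → ℝ}

/-- Mixing an exchangeable off-diagonal pair `(x, y)` with the diagonal pair `(x, x)`: the mixture
is compared with the conditionally independent coupling by Gibbs' inequality. -/
theorem one_add_exp_entropy_sub_le_of_exchangeable (hp : ∀ c x y, 0 ≤ p c x y)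
    (hsymm : ∀ c x y, p c x y = p c y x) (hdiag : ∀ c x, p c x x = 0)
    (hp₁ : ∀ c x, ∑ y, p c x y = p₁ c x) (hp₀ : ∀ c, ∑ x, p₁ c x = p₀ c) (hsum : ∑ c, p₀ c = 1) :
    1 + Real.exp (entropy (fun i : C × V × V => p i.1 i.2.1 i.2.2) -
        entropy (fun i : C × V => p₁ i.1 i.2)) ≤
      Real.exp (entropy (fun i : C × V => p₁ i.1 i.2) - entropy p₀) ∧
    (1 + Real.exp (entropy (fun i : C × V × V => p i.1 i.2.1 i.2.2) -
        entropy (fun i : C × V => p₁ i.1 i.2)) =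
      Real.exp (entropy (fun i : C × V => p₁ i.1 i.2) - entropy p₀) →
      ∃ l : ℝ, ∀ c x, p₁ c x ≠ 0 → p₁ c x = l * p₀ c) := by
  classical
  set E := entropy (fun i : C × V × V => p i.1 i.2.1 i.2.2) with hE
  set E₁ := entropy (fun i : C × V => p₁ i.1 i.2) with hE₁
  set E₀ := entropy p₀ with hE₀
  set u := Real.exp (E - E₁) with hu
  have hu0 : 0 < u := Real.exp_pos _
  -- This weight maximises the binary entropy of l plus (1 - l)(E - E₁); the maximum is log(1 + u).
  set l := 1 / (1 + u) with hl
  have hl0 : 0 < l := by positivity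
  have hl1 : 1 - l = u / (1 + u) := by rw [hl]; field_simp; ring
  have hl10 : 0 < 1 - l := by rw [hl1]; positivity
  have hlogl : Real.log l = -Real.log (1 + u) := by simp [hl]
  have hlogl1 : Real.log (1 - l) = E - E₁ - Real.log (1 + u) := by
    rw [hl1, Real.log_div hu0.ne' (by positivity), hu, Real.log_exp]
  have hp₁0 : ∀ c x, 0 ≤ p₁ c x := fun c x => hp₁ c x ▸ Finset.sum_nonneg fun y _ => hp c x y
  have hp₀0 : ∀ c, 0 ≤ p₀ c := fun c => hp₀ c ▸ Finset.sum_nonneg fun y _ => hp₁0 c y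
  have hz₁ : ∀ c x y, p₁ c x = 0 → p c x y = 0 := fun c x y h => by
    rw [← hp₁, Finset.sum_eq_zero_iff_of_nonneg fun y _ => hp c x y] at h
    exact h y (Finset.mem_univ y)
  have hz₀ : ∀ c x, p₀ c = 0 → p₁ c x = 0 := fun c x h => by
    rw [← hp₀, Finset.sum_eq_zero_iff_of_nonneg fun y _ => hp₁0 c y] at h
    exact h x (Finset.mem_univ x)
  set q : C × V × V → ℝ := fun i =>
    (if i.2.1 = i.2.2 then l * p₁ i.1 i.2.1 else 0) + (1 - l) * p i.1 i.2.1 i.2.2 with hq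
  -- The coupling of x and y independent given c. It has the same pair marginals as `q`; where `p₀`
  -- vanishes the value 0 is the right one.
  set t : C × V × V → ℝ := fun i => p₁ i.1 i.2.1 * p₁ i.1 i.2.2 / p₀ i.1 with ht
  have hsum₁ : ∑ c, ∑ x, p₁ c x = 1 := by simp [hp₀, hsum]
  have hsumt : ∑ i, t i = 1 := by
    simp only [ht, Fintype.sum_prod_type, ← Finset.sum_div, ← Finset.mul_sum, ← Finset.sum_mul, hp₀]
    rw [← hsum]
    exact Finset.sum_congr rfl fun c _ => by
      by_cases h : p₀ c = 0
      · simp [h]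
      · field_simp
  have hsumq : ∑ i, q i = 1 := by
    simp only [hq, Fintype.sum_prod_type, Finset.sum_add_distrib, Finset.sum_ite_eq, Finset.mem_univ,
      if_true, ← Finset.mul_sum, hp₁, hp₀, hsum]
    ring
  have hq0 : ∀ i, 0 ≤ q i := fun i => by
    have h1 := mul_nonneg hl0.le (hp₁0 i.1 i.2.1)
    have h2 := mul_nonneg hl10.le (hp i.1 i.2.1 i.2.2)
    simp only [hq]
    split_ifs <;> linarith
  have ht0 : ∀ i, 0 ≤ t i := fun i => div_nonneg (mul_nonneg (hp₁0 _ _) (hp₁0 _ _)) (hp₀0 _)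
  have htq : ∀ i, t i = 0 → q i = 0 := by
    rintro ⟨c, x, y⟩ h
    simp only [ht, div_eq_zero_iff, mul_eq_zero] at h
    simp only [hq]
    rcases h with (h | h) | h
    · simp [h, hz₁ c x y h]
    · have h' : p c x y = 0 := by rw [hsymm]; exact hz₁ c y x h
      by_cases hxy : x = y
      · subst hxy; simp [h, h']
      · simp [hxy, h']
    · simp [hz₀ c x h, hz₁ c x y (hz₀ c x h)]
  have hpt : ∀ i : C × V × V, q i * (Real.log (t i) - Real.log (q i)) =
      (if i.2.1 = i.2.2 then l * (p₁ i.1 i.2.1 * Real.log (p₁ i.1 i.2.1) -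
          p₁ i.1 i.2.1 * Real.log (p₀ i.1) - p₁ i.1 i.2.1 * Real.log l) else 0) +
      (1 - l) * (p i.1 i.2.1 i.2.2 * Real.log (p₁ i.1 i.2.1) +
        p i.1 i.2.1 i.2.2 * Real.log (p₁ i.1 i.2.2) - p i.1 i.2.1 i.2.2 * Real.log (p₀ i.1) -
        p i.1 i.2.1 i.2.2 * Real.log (1 - l) -
        p i.1 i.2.1 i.2.2 * Real.log (p i.1 i.2.1 i.2.2)) := by
    rintro ⟨c, x, y⟩
    simp only [hq, ht]
    by_cases hxy : x = y
    · subst hxy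
      simp only [if_true, hdiag, mul_zero, add_zero, zero_mul, sub_zero]
      by_cases h1 : p₁ c x = 0
      · simp [h1]
      have h0 : p₀ c ≠ 0 := fun h => h1 (hz₀ c x h)
      rw [Real.log_div (by positivity) h0, Real.log_mul h1 h1, Real.log_mul hl0.ne' h1]
      ring
    · simp only [hxy, if_false, zero_add]
      by_cases h : p c x y = 0
      · simp [h]
      have h1 : p₁ c x ≠ 0 := fun h' => h (hz₁ c x y h')
      have h2 : p₁ c y ≠ 0 := fun h' => h (by rw [hsymm]; exact hz₁ c y x h')
      have h0 : p₀ c ≠ 0 := fun h => h1 (hz₀ c x h)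
      rw [Real.log_div (by positivity) h0, Real.log_mul h1 h2, Real.log_mul hl10.ne' h]
      ring
  have key : ∑ i, q i * (Real.log (t i) - Real.log (q i)) = Real.log (1 + u) - (E₁ - E₀) := by
    have e1 : ∑ c, ∑ x, ∑ y, p c x y * Real.log (p₁ c x) = -E₁ := by
      simp only [← Finset.sum_mul, hp₁]
      rw [hE₁, entropy_eq_neg_sum, Fintype.sum_prod_type, neg_neg]
    have e2 : ∑ c, ∑ x, ∑ y, p c x y * Real.log (p₁ c y) = -E₁ := by
      rw [← e1]
      refine Finset.sum_congr rfl fun c _ => ?_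
      rw [Finset.sum_comm]
      exact Finset.sum_congr rfl fun x _ => Finset.sum_congr rfl fun y _ => by rw [hsymm]
    have e3 : ∑ c, ∑ x, p₁ c x * Real.log (p₁ c x) = -E₁ := by
      rw [hE₁, entropy_eq_neg_sum, Fintype.sum_prod_type, neg_neg]
    have e4 : ∑ c, p₀ c * Real.log (p₀ c) = -E₀ := by
      rw [hE₀, entropy_eq_neg_sum, neg_neg]
    have e5 : ∑ c, ∑ x, ∑ y, p c x y * Real.log (p c x y) = -E := by
      rw [hE, entropy_eq_neg_sum, Fintype.sum_prod_type, neg_neg]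
      simp only [Fintype.sum_prod_type]
    simp only [hpt, Fintype.sum_prod_type, Finset.sum_add_distrib, Finset.sum_ite_eq,
      Finset.mem_univ, if_true, ← Finset.mul_sum, Finset.sum_sub_distrib, e1, e2, e3, e5]
    simp only [← Finset.sum_mul, hp₁, hp₀, hsum, e4, hlogl, hlogl1]
    ring
  have hgibbs := sum_mul_log_sub_log_nonpos hq0 ht0 htq (by rw [hsumt, hsumq])
  rw [key] at hgibbs
  have h1u : 0 < 1 + u := by positivity
  refine ⟨?_, fun h => ⟨l, fun c x hx => ?_⟩⟩
  · rw [← Real.log_le_iff_le_exp h1u]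
    linarith
  · have h0 : Real.log (1 + u) - (E₁ - E₀) = 0 := by rw [h, Real.log_exp, sub_self]
    -- On the diagonal the equality q = t reads l p₁ = p₁² / p₀, so p₁ = l p₀ wherever p₁ ≠ 0.
    have hqt := eq_of_sum_mul_log_sub_log_eq_zero hq0 ht0 htq (by rw [hsumt, hsumq])
      (key.trans h0) (c, x, x)
    simp only [hq, ht, hdiag, if_true, mul_zero, add_zero] at hqt
    have h0 : p₀ c ≠ 0 := fun h => hx (hz₀ c x h)
    rw [eq_div_iff h0] at hqt
    exact mul_left_cancel₀ hx (by linarith)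

end Exchangeable

/-! ### Marginals of a randomly ordered edge -/

section Marginals

open Finset

variable {V : Type*} [DecidableEq V]

/-- The total weight of the edges containing `A`. -/
def upperWeight (E : Finset (Finset V)) (w : Finset V → ℝ) (A : Finset V) : ℝ :=
  ∑ e ∈ E with A ⊆ e, w e

theorem upperWeight_empty (E : Finset (Finset V)) (w : Finset V → ℝ) :
    upperWeight E w ∅ = ∑ e ∈ E, w e := by
  simp [upperWeight]

theorem upperWeight_nonneg {E : Finset (Finset V)} {w : Finset V → ℝ} (hw : ∀ e, 0 ≤ w e)
    (A : Finset V) : 0 ≤ upperWeight E w A :=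
  sum_nonneg fun e _ => hw e

theorem upperWeight_of_card_eq {r : ℕ} {E : Finset (Finset V)} (hE : ∀ e ∈ E, e.card = r)
    (w : Finset V → ℝ) {A : Finset V} (hA : A.card = r) :
    upperWeight E w A = if A ∈ E then w A else 0 := by
  rw [upperWeight, sum_filter, ← sum_ite_eq' E A w]
  refine sum_congr rfl fun e he => ?_
  congr 1
  exact propext ⟨fun h => (eq_of_subset_of_card_le h (by rw [hE e he, hA])).symm,
    fun h => h ▸ Subset.rfl⟩

/-- Double counting: an edge e ⊇ A is counted once for each of the r - |A| vertices of e \ A. -/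
theorem sum_upperWeight_insert [Fintype V] {r : ℕ} {E : Finset (Finset V)}
    (hE : ∀ e ∈ E, e.card = r) (w : Finset V → ℝ) (A : Finset V) :
    ∑ v, (if v ∈ A then 0 else upperWeight E w (insert v A)) =
      ((r : ℝ) - A.card) * upperWeight E w A := by
  have h : ∀ v, (if v ∈ A then 0 else upperWeight E w (insert v A)) =
      ∑ e ∈ E, if v ∈ e \ A then (if A ⊆ e then w e else 0) else 0 := by
    intro v
    split_ifs with hv
    · simp [hv]
    · rw [upperWeight, sum_filter]
      refine sum_congr rfl fun e _ => ?_
      simp only [insert_subset_iff, mem_sdiff, hv, not_false_eq_true, and_true]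
      split_ifs <;> simp_all
  simp only [h]
  rw [sum_comm, upperWeight, sum_filter, mul_sum]
  refine sum_congr rfl fun e he => ?_
  rw [sum_ite_mem, univ_inter, sum_const, nsmul_eq_mul]
  split_ifs with hA
  · rw [card_sdiff_of_subset hA, Nat.cast_sub (card_le_card hA), hE e he]
  · simp

/-- The marginal weight of the first `k` entries of a uniformly random ordering of an edge of size
`r` which is chosen with weight `w`. -/
noncomputable def orderedMarginal (r : ℕ) (E : Finset (Finset V)) (w : Finset V → ℝ) (k : ℕ)
    (t : Fin k → V) : ℝ :=
  open Classical in
  if Function.Injective t then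
    -- Of the r! orderings of an edge containing the image of `t`, exactly (r - k)! begin with `t`.
    upperWeight E w (univ.image t) * ((r - k).factorial / r.factorial) else 0

theorem image_cons {k : ℕ} (v : V) (t : Fin k → V) :
    univ.image (Fin.cons v t : Fin (k + 1) → V) = insert v (univ.image t) := by
  ext x
  simp [Fin.exists_fin_succ, eq_comm]

theorem injective_cons_iff {k : ℕ} (v : V) (t : Fin k → V) :
    Function.Injective (Fin.cons v t : Fin (k + 1) → V) ↔
      v ∉ univ.image t ∧ Function.Injective t := by
  rw [Fin.cons_injective_iff]
  simp

variable {r : ℕ} {E : Finset (Finset V)} {w : Finset V → ℝ} {k : ℕ}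

theorem orderedMarginal_nonneg (hw : ∀ e, 0 ≤ w e) (t : Fin k → V) :
    0 ≤ orderedMarginal r E w k t := by
  have := upperWeight_nonneg (E := E) hw (univ.image t)
  rw [orderedMarginal]
  positivity

theorem orderedMarginal_cons_cons_comm (t : Fin k → V) (x y : V) :
    orderedMarginal r E w (k + 2) (Fin.cons y (Fin.cons x t)) =
      orderedMarginal r E w (k + 2) (Fin.cons x (Fin.cons y t)) := by
  simp only [orderedMarginal, injective_cons_iff, image_cons, Finset.insert_comm y x]
  congr 1
  simp only [mem_insert, not_or, eq_iff_iff, eq_comm (a := x) (b := y)]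
  tauto

theorem orderedMarginal_cons_cons_self (t : Fin k → V) (x : V) :
    orderedMarginal r E w (k + 2) (Fin.cons x (Fin.cons x t)) = 0 := by
  simp [orderedMarginal, injective_cons_iff, image_cons]

theorem orderedMarginal_one (hr : r ≠ 0) (t : Fin 0 → V) (v : V) :
    orderedMarginal r E w 1 (Fin.cons v t) = upperWeight E w {v} / r := by
  obtain ⟨r, rfl⟩ := Nat.exists_eq_succ_of_ne_zero hr
  have h : Function.Injective t := fun i => i.elim0
  have h2 : univ.image t = ∅ := by simp
  have h3 : ((r.factorial : ℕ) : ℝ) ≠ 0 := by positivity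
  simp only [orderedMarginal, injective_cons_iff, image_cons, h, h2]
  simp [Nat.factorial_succ]
  field_simp

theorem orderedMarginal_top (hE : ∀ e ∈ E, e.card = r) (t : Fin r → V) :
    orderedMarginal r E w r t =
      open Classical in
      if Function.Injective t ∧ univ.image t ∈ E then w (univ.image t) / r.factorial else 0 := by
  rw [orderedMarginal]
  by_cases ht : Function.Injective t
  · rw [upperWeight_of_card_eq hE w (by simp [card_image_of_injective _ ht])]
    simp only [ht, if_true, true_and, Nat.sub_self, Nat.factorial_zero]
    split_ifs <;> simp [div_eq_mul_inv]
  · simp [ht]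

variable [Fintype V]

theorem sum_orderedMarginal_cons (hE : ∀ e ∈ E, e.card = r) (hk : k < r) (t : Fin k → V) :
    ∑ v, orderedMarginal r E w (k + 1) (Fin.cons v t) = orderedMarginal r E w k t := by
  simp only [orderedMarginal, injective_cons_iff, image_cons]
  by_cases ht : Function.Injective t
  · simp only [ht, and_true, if_true]
    have h := sum_upperWeight_insert hE w (univ.image t)
    rw [card_image_of_injective _ ht, card_univ, Fintype.card_fin] at h
    have h2 : ((r - k).factorial : ℝ) = ((r : ℝ) - k) * ((r - (k + 1)).factorial) := by
      obtain ⟨j, rfl⟩ : ∃ j, r = k + 1 + j := ⟨r - (k + 1), by omega⟩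
      rw [show k + 1 + j - k = j + 1 by omega, show k + 1 + j - (k + 1) = j by omega,
        Nat.factorial_succ]
      push_cast
      ring
    rw [h2, mul_div_assoc, ← mul_assoc, mul_comm (upperWeight _ _ _) ((r : ℝ) - k), ← h, sum_mul]
    refine sum_congr rfl fun v _ => ?_
    split_ifs <;> simp_all
  · simp [ht]

/-- Appending a first entry to a tuple. -/
def consTupleEquiv (V : Type*) (k : ℕ) : (Fin k → V) × V ≃ (Fin (k + 1) → V) :=
  (Equiv.prodComm _ _).trans (Fin.consEquiv fun _ => V)

theorem sum_orderedMarginal (hE : ∀ e ∈ E, e.card = r) (hk : k ≤ r) :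
    ∑ t, orderedMarginal r E w k t = ∑ e ∈ E, w e := by
  induction k with
  | zero =>
    have h : ∀ t : Fin 0 → V, Function.Injective t := fun t i => i.elim0
    have h3 : ((r.factorial : ℕ) : ℝ) ≠ 0 := by positivity
    simp [orderedMarginal, h, upperWeight_empty, h3]
  | succ k ih =>
    rw [← ih (by omega), ← (consTupleEquiv V k).sum_comp, Fintype.sum_prod_type]
    exact sum_congr rfl fun t _ => sum_orderedMarginal_cons hE (by omega) t

theorem entropy_comp_equiv {α β : Type*} [Fintype α] [Fintype β] (e : α ≃ β) (f : β → ℝ) :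
    entropy (fun a => f (e a)) = entropy f :=
  e.sum_comp fun b => Real.negMulLog (f b)

/-- Given the first k entries, the next two form an exchangeable off-diagonal pair, so the preceding
section applies. -/
theorem one_add_exp_entropy_orderedMarginal_le (hE : ∀ e ∈ E, e.card = r) (hw : ∀ e, 0 ≤ w e)
    (hsum : ∑ e ∈ E, w e = 1) (hk : k + 2 ≤ r) :
    1 + Real.exp (entropy (orderedMarginal r E w (k + 2)) -
        entropy (orderedMarginal r E w (k + 1))) ≤
      Real.exp (entropy (orderedMarginal r E w (k + 1)) - entropy (orderedMarginal r E w k)) ∧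
    (1 + Real.exp (entropy (orderedMarginal r E w (k + 2)) -
        entropy (orderedMarginal r E w (k + 1))) =
      Real.exp (entropy (orderedMarginal r E w (k + 1)) - entropy (orderedMarginal r E w k)) →
      ∃ l : ℝ, ∀ t v, orderedMarginal r E w (k + 1) (Fin.cons v t) ≠ 0 →
        orderedMarginal r E w (k + 1) (Fin.cons v t) = l * orderedMarginal r E w k t) := by
  have h := one_add_exp_entropy_sub_le_of_exchangeable
    (p := fun (t : Fin k → V) x y => orderedMarginal r E w (k + 2) (Fin.cons y (Fin.cons x t)))
    (p₁ := fun (t : Fin k → V) x => orderedMarginal r E w (k + 1) (Fin.cons x t))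
    (p₀ := orderedMarginal r E w k)
    (fun _ _ _ => orderedMarginal_nonneg hw _)
    (fun t x y => orderedMarginal_cons_cons_comm t x y)
    (fun t x => orderedMarginal_cons_cons_self t x)
    (fun t x => sum_orderedMarginal_cons hE (by omega) _)
    (fun t => sum_orderedMarginal_cons hE (by omega) _)
    ((sum_orderedMarginal hE (by omega)).trans hsum)
  have h1 : entropy (fun i : (Fin k → V) × V => orderedMarginal r E w (k + 1) (Fin.cons i.2 i.1)) =
      entropy (orderedMarginal r E w (k + 1)) :=
    entropy_comp_equiv (consTupleEquiv V k) _
  have h2 : entropy (fun i : (Fin k → V) × V × V =>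
        orderedMarginal r E w (k + 2) (Fin.cons i.2.2 (Fin.cons i.2.1 i.1))) =
      entropy (orderedMarginal r E w (k + 2)) :=
    entropy_comp_equiv (((Equiv.prodAssoc _ _ _).symm.trans
      ((consTupleEquiv V k).prodCongr (Equiv.refl V))).trans (consTupleEquiv V (k + 1))) _
  rw [h1, h2] at h
  exact h

theorem entropy_orderedMarginal_zero (hsum : ∑ e ∈ E, w e = 1) :
    entropy (orderedMarginal r E w 0) = 0 := by
  have h : ∀ t : Fin 0 → V, Function.Injective t := fun t i => i.elim0
  have h3 : ((r.factorial : ℕ) : ℝ) ≠ 0 := by positivity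
  simp [entropy, orderedMarginal, h, upperWeight_empty, h3, hsum]

theorem entropy_orderedMarginal_one (hr : r ≠ 0) :
    entropy (orderedMarginal r E w 1) = entropy fun v => upperWeight E w {v} / r := by
  rw [← entropy_comp_equiv (consTupleEquiv V 0), entropy, Fintype.sum_prod_type,
    Fintype.sum_unique, entropy]
  exact sum_congr rfl fun v _ => congrArg _ (orderedMarginal_one hr _ v)

theorem card_orderings (hE : ∀ e ∈ E, e.card = r) :
    open Classical in
    ((univ.filter fun t : Fin r → V => Function.Injective t ∧ univ.image t ∈ E).card : ℝ) =
      r.factorial * E.card := by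
  classical
  have h := sum_orderedMarginal (w := fun _ => (1 : ℝ)) hE le_rfl
  have h3 : ((r.factorial : ℕ) : ℝ) ≠ 0 := by positivity
  simp only [orderedMarginal_top hE, ← sum_filter, sum_const, nsmul_eq_mul] at h
  field_simp at h
  linarith

/-- Counting only edges of nonzero weight is what later shows that, in the equality case, every edge
has nonzero weight. -/
theorem entropy_orderedMarginal_top_le (hE : ∀ e ∈ E, e.card = r) (hw : ∀ e, 0 ≤ w e)
    (hsum : ∑ e ∈ E, w e = 1) :
    entropy (orderedMarginal r E w r) ≤
      Real.log (r.factorial * (E.filter fun e => w e ≠ 0).card) := by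
  classical
  rw [← card_orderings fun e he => hE e (mem_filter.1 he).1]
  refine entropy_le_log_card (fun t => orderedMarginal_nonneg hw t)
    ((sum_orderedMarginal hE le_rfl).trans hsum) fun t ht => ?_
  rw [orderedMarginal_top hE, ite_eq_right_iff]
  rintro ⟨h1, h2⟩
  by_contra h
  refine ht (mem_filter.2 ⟨mem_univ _, h1, mem_filter.2 ⟨h2, fun h' => h (by simp [h'])⟩⟩)

theorem entropy_orderedMarginal_top (hE : ∀ e ∈ E, e.card = r) :
    entropy (orderedMarginal r E w r) =
      ∑ e ∈ E, r.factorial * Real.negMulLog (w e / r.factorial) := by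
  classical
  have h3 : ((r.factorial : ℕ) : ℝ) ≠ 0 := by positivity
  rw [← sum_orderedMarginal (k := r) hE le_rfl, entropy]
  refine sum_congr rfl fun t _ => ?_
  rw [orderedMarginal_top hE, orderedMarginal_top hE]
  split_ifs
  · field_simp
  · simp

end Marginals

/-! ### Entropy and the Lagrangian -/

section LagrangianBound

open Finset

variable {V : Type*} [DecidableEq V] {r : ℕ} {E : Finset (Finset V)} {x : V → ℝ}

theorem sum_upperWeight_singleton [Fintype V] (hE : ∀ e ∈ E, e.card = r) (w : Finset V → ℝ) :
    ∑ v, upperWeight E w {v} = r * ∑ e ∈ E, w e := by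
  simpa [upperWeight_empty] using sum_upperWeight_insert hE w ∅

theorem sum_mul_upperWeight_singleton [Fintype V] (w : Finset V → ℝ) (f : V → ℝ) :
    ∑ v, upperWeight E w {v} * f v = ∑ e ∈ E, w e * ∑ i ∈ e, f i := by
  have h : ∀ v, upperWeight E w {v} * f v = ∑ e ∈ E, if v ∈ e then w e * f v else 0 := by
    intro v
    rw [upperWeight, sum_filter, sum_mul]
    exact sum_congr rfl fun e _ => by simp
  simp only [h]
  rw [sum_comm]
  refine sum_congr rfl fun e _ => ?_
  rw [sum_ite_mem, univ_inter, mul_sum]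

variable [Fintype V]

theorem log_add_mul_entropy_le (hr : r ≠ 0) (hE : ∀ e ∈ E, e.card = r) (hx : ∀ i, 0 ≤ x i)
    (hx1 : ∑ i, x i = 1) {P : ℝ} (hP : ∑ e ∈ E, ∏ i ∈ e, x i = P) (hP0 : 0 < P) :
    Real.log (r.factorial * P) +
        r * entropy (orderedMarginal r E (fun e => (∏ i ∈ e, x i) / P) 1) ≤
      entropy (orderedMarginal r E (fun e => (∏ i ∈ e, x i) / P) r) := by
  set w : Finset V → ℝ := fun e => (∏ i ∈ e, x i) / P with hw
  have hw0 : ∀ e, 0 ≤ w e := fun e => div_nonneg (prod_nonneg fun i _ => hx i) hP0.le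
  have hsum : ∑ e ∈ E, w e = 1 := by
    rw [hw, ← sum_div, hP, div_self hP0.ne']
  have hr0 : (r : ℝ) ≠ 0 := by exact_mod_cast hr
  have hf : ((r.factorial : ℕ) : ℝ) ≠ 0 := by positivity
  have h1 : entropy (orderedMarginal r E w r) = Real.log (r.factorial * P) -
      ∑ v, upperWeight E w {v} * Real.log (x v) := by
    have h2 : ∀ e ∈ E, r.factorial * Real.negMulLog (w e / r.factorial) =
        w e * Real.log (r.factorial * P) - w e * ∑ i ∈ e, Real.log (x i) := by
      intro e _
      by_cases h : ∏ i ∈ e, x i = 0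
      · simp [hw, h]
      rw [← Real.log_prod (fun i hi h' => h (prod_eq_zero hi h')), Real.negMulLog,
        Real.log_div (div_ne_zero h hP0.ne') hf, Real.log_div h hP0.ne', Real.log_mul hf hP0.ne']
      field_simp
      ring
    rw [entropy_orderedMarginal_top hE, sum_congr rfl h2, sum_sub_distrib, ← sum_mul, hsum, one_mul,
      sum_mul_upperWeight_singleton]
  -- The law of one random vertex of the edge is compared with x; r times this inequality bounds the
  -- sum in `h1`.
  have hg := sum_mul_log_sub_log_nonpos (p := fun v => upperWeight E w {v} / r) (q := x)
    (fun v => div_nonneg (upperWeight_nonneg hw0 _) (Nat.cast_nonneg r)) hx (by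
      intro v hv
      rw [upperWeight, sum_eq_zero, zero_div]
      intro e he
      have hve : v ∈ e := by simpa using (mem_filter.1 he).2
      simp [hw, prod_eq_zero hve hv])
    (by rw [hx1, ← sum_div, sum_upperWeight_singleton hE, hsum, mul_one, div_self hr0])
  rw [h1, entropy_orderedMarginal_one hr, entropy_eq_neg_sum]
  simp only [mul_sub, sum_sub_distrib] at hg
  have h3 : ∑ v, upperWeight E w {v} * Real.log (x v) =
      r * ∑ v, upperWeight E w {v} / r * Real.log (x v) := by
    rw [mul_sum]
    exact sum_congr rfl fun v _ => by field_simp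
  rw [h3]
  have h4 := mul_le_mul_of_nonneg_left hg (Nat.cast_nonneg (α := ℝ) r)
  linarith

/-- The entropy of a probability vector which is constant on its support is the logarithm of the
size of the support. -/
theorem exp_entropy_eq_card {α : Type*} [Fintype α] {f : α → ℝ} (hsum : ∑ a, f a = 1) {l : ℝ}
    (hl : ∀ a, f a ≠ 0 → f a = l) :
    Real.exp (entropy f) = (univ.filter fun a => f a ≠ 0).card := by
  have hf : ∀ a, f a = if f a ≠ 0 then l else 0 := fun a => by
    split_ifs with h
    · exact hl a h
    · exact not_not.1 h
  have h1 : ((univ.filter fun a => f a ≠ 0).card : ℝ) * l = 1 := by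
    rw [← hsum, sum_congr rfl fun a _ => hf a, ← sum_filter, sum_const, nsmul_eq_mul]
  have h2 : entropy f = -Real.log l := by
    rw [entropy_eq_neg_sum, neg_inj]
    calc ∑ a, f a * Real.log (f a) = ∑ a, f a * Real.log l := sum_congr rfl fun a _ => by
          by_cases h : f a = 0
          · simp [h]
          · rw [hl a h]
      _ = Real.log l := by rw [← sum_mul, hsum, one_mul]
  have hc : (0 : ℝ) < (univ.filter fun a => f a ≠ 0).card := by
    refine (Nat.cast_nonneg _).lt_of_ne fun h => ?_
    rw [← h, zero_mul] at h1
    exact zero_ne_one h1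
  have hl0 : 0 < l := pos_of_mul_pos_right (h1 ▸ one_pos) hc.le
  rw [h2, Real.exp_neg, Real.exp_log hl0]
  exact inv_eq_of_mul_eq_one_left h1

/-- The exponentials of the successive conditional entropies of a random ordered edge. -/
theorem exists_exp_conditional_entropies (hr : 2 ≤ r) (hE : ∀ e ∈ E, e.card = r)
    (hx : ∀ i, 0 ≤ x i) (hx1 : ∑ i, x i = 1) {P : ℝ} (hP : ∑ e ∈ E, ∏ i ∈ e, x i = P)
    (hP0 : 0 < P) :
    ∃ a : ℕ → ℝ, (∀ k, 0 < a k) ∧ (∀ k, k + 1 < r → a (k + 1) + 1 ≤ a k) ∧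
      ∏ k ∈ range r, a k ≤ r.factorial * (E.filter fun e => ∏ i ∈ e, x i ≠ 0).card ∧
      r.factorial * P * a 0 ^ r ≤ ∏ k ∈ range r, a k ∧
      (a 1 + 1 = a 0 → ∃ S : Finset V, (S.card : ℝ) = a 0 ∧
        ∀ e ∈ E, ∏ i ∈ e, x i ≠ 0 → e ⊆ S) := by
  have hr' : r ≠ 0 := by omega
  set w : Finset V → ℝ := fun e => (∏ i ∈ e, x i) / P with hw
  have hw0 : ∀ e, 0 ≤ w e := fun e => div_nonneg (prod_nonneg fun i _ => hx i) hP0.le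
  have hsum : ∑ e ∈ E, w e = 1 := by
    rw [hw, ← sum_div, hP, div_self hP0.ne']
  have hwne : ∀ e, w e ≠ 0 ↔ ∏ i ∈ e, x i ≠ 0 := fun e => by simp [hw, hP0.ne']
  have hr0 : (r : ℝ) ≠ 0 := by exact_mod_cast hr'
  set S : ℕ → ℝ := fun k => entropy (orderedMarginal r E w k) with hS
  have hS0 : S 0 = 0 := entropy_orderedMarginal_zero hsum
  have hprod : ∏ k ∈ range r, Real.exp (S (k + 1) - S k) = Real.exp (S r) := by
    rw [← Real.exp_sum, sum_range_sub, hS0, sub_zero]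
  have hm0 : (0 : ℝ) < (E.filter fun e => w e ≠ 0).card := by
    rw [Nat.cast_pos, card_pos, nonempty_iff_ne_empty]
    intro h
    have h0 : ∑ e ∈ E, w e = 0 := sum_eq_zero fun e he => by
      by_contra hne
      have : e ∈ E.filter fun e => w e ≠ 0 := mem_filter.2 ⟨he, hne⟩
      simp [h] at this
    linarith
  refine ⟨fun k => Real.exp (S (k + 1) - S k), fun k => Real.exp_pos _, fun k hk => ?_, ?_, ?_, ?_⟩
  · have := (one_add_exp_entropy_orderedMarginal_le (k := k) hE hw0 hsum (by omega)).1
    rw [add_comm]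
    exact this
  · rw [hprod, ← Real.le_log_iff_exp_le]
    · simp only [← hwne]
      exact entropy_orderedMarginal_top_le hE hw0 hsum
    · simp only [← hwne]
      positivity
  · have h := log_add_mul_entropy_le hr' hE hx hx1 hP hP0
    rw [hprod]
    calc r.factorial * P * Real.exp (S (0 + 1) - S 0) ^ r
        = Real.exp (Real.log (r.factorial * P) + r * S 1) := by
          rw [Real.exp_add, Real.exp_log (by positivity), Real.exp_nat_mul, hS0, sub_zero, zero_add]
      _ ≤ Real.exp (S r) := Real.exp_le_exp.2 h
  · intro heq
    obtain ⟨l, hl⟩ := (one_add_exp_entropy_orderedMarginal_le (k := 0) hE hw0 hsum hr).2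
      (by rw [add_comm]; exact heq)
    -- For k = 0 the conditioning is trivial, so proportionality says that the law of one vertex is
    -- constant on its support.
    set l' := l * orderedMarginal r E w 0 Fin.elim0
    have hπ : ∑ v, upperWeight E w {v} / r = 1 := by
      rw [← sum_div, sum_upperWeight_singleton hE, hsum, mul_one, div_self hr0]
    have hcard := exp_entropy_eq_card hπ (l := l') fun v hv => by
      rw [← orderedMarginal_one hr' Fin.elim0] at hv ⊢
      exact hl _ _ hv
    refine ⟨univ.filter fun v => upperWeight E w {v} / r ≠ 0, ?_, fun e he hne v hv => ?_⟩
    · simp only [zero_add, hS0, sub_zero]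
      rw [← hcard, ← entropy_orderedMarginal_one hr']
    · refine mem_filter.2 ⟨mem_univ _, div_ne_zero (ne_of_gt ?_) hr0⟩
      have h1 : 0 < w e := (hw0 e).lt_of_ne ((hwne e).2 hne).symm
      exact h1.trans_le (single_le_sum (f := w) (fun e _ => hw0 e)
        (mem_filter.2 ⟨he, by simpa using hv⟩))

end LagrangianBound

/-! ### The numerical inequality -/

section Numeric

open Finset

/-- If a 0 > s, the bound on the product suffices, strictly. If a 0 ≤ s, the steps give a k / a 0 ≤
1 - k / a 0 ≤ 1 - k / s factor by factor. -/
theorem prod_div_pow_le {r : ℕ} {a : ℕ → ℝ} {s : ℝ} (hr : 2 ≤ r) (ha : ∀ k, 0 < a k)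
    (hstep : ∀ k, k + 1 < r → a (k + 1) + 1 ≤ a k) (hs : (r : ℝ) - 1 < s)
    (hprod : ∏ k ∈ range r, a k ≤ ∏ k ∈ range r, (s - k)) :
    (∏ k ∈ range r, a k) / a 0 ^ r ≤ (∏ k ∈ range r, (s - k)) / s ^ r ∧
      ((∏ k ∈ range r, a k) / a 0 ^ r = (∏ k ∈ range r, (s - k)) / s ^ r →
        a 0 = s ∧ a 1 + 1 = a 0) := by
  have hr2 : (2 : ℝ) ≤ r := by exact_mod_cast hr
  have hs0 : 0 < s := by linarith
  have ha0 := ha 0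
  have hle : ∀ k, k < r → a k ≤ a 0 - k := by
    intro k
    induction k with
    | zero => simp
    | succ k ih =>
      intro hk
      have h1 := ih (by omega)
      have h2 := hstep k hk
      push_cast
      linarith
  have hD : 0 < ∏ k ∈ range r, (s - k) := (prod_pos fun k _ => ha k).trans_le hprod
  rcases lt_or_ge s (a 0) with hlt | hge
  · have h : (∏ k ∈ range r, a k) / a 0 ^ r < (∏ k ∈ range r, (s - k)) / s ^ r :=
      calc (∏ k ∈ range r, a k) / a 0 ^ r ≤ (∏ k ∈ range r, (s - k)) / a 0 ^ r := by gcongr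
        _ < (∏ k ∈ range r, (s - k)) / s ^ r :=
          div_lt_div_of_pos_left hD (by positivity) (pow_lt_pow_left₀ hlt hs0.le (by omega))
    exact ⟨h.le, fun h' => absurd h' h.ne⟩
  · have hrw : ∀ (f : ℕ → ℝ) (y : ℝ), (∏ k ∈ range r, f k) / y ^ r = ∏ k ∈ range r, f k / y :=
      fun f y => by rw [prod_div_distrib, prod_const, card_range]
    have hpos : ∀ k ∈ range r, 0 < a k / a 0 := fun k _ => div_pos (ha k) ha0
    have hfac : ∀ k ∈ range r, a k / a 0 ≤ (s - k) / s := by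
      intro k hk
      have h1 := hle k (mem_range.1 hk)
      rw [div_le_div_iff₀ ha0 hs0]
      have h2 : (k : ℝ) * a 0 ≤ k * s := by gcongr
      nlinarith
    rw [hrw, hrw]
    refine ⟨prod_le_prod (fun k hk => (hpos k hk).le) hfac, fun h => ?_⟩
    have h1 : a 1 / a 0 = (s - 1) / s := by
      by_contra hne
      have h1r : 1 ∈ range r := mem_range.2 (by omega)
      refine (prod_lt_prod hpos hfac ⟨1, h1r, lt_of_le_of_ne (hfac 1 h1r) ?_⟩).ne h
      simpa using hne
    have h2 := hstep 0 (by omega)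
    rw [div_eq_div_iff ha0.ne' hs0.ne'] at h1
    -- From (s - 1) a 0 = s a 1 ≤ s (a 0 - 1) follows s ≤ a 0.
    have h3 : a 0 = s := by
      refine le_antisymm hge ?_
      rw [zero_add] at h2
      nlinarith
    refine ⟨h3, ?_⟩
    rw [h3] at h1
    have := mul_right_cancel₀ hs0.ne' h1
    linarith

theorem factorial_mul_ringChoose (s : ℝ) (r : ℕ) :
    r.factorial * Ring.choose s r = ∏ k ∈ range r, (s - k) := by
  rw [← nsmul_eq_mul, ← Ring.descPochhammer_eq_factorial_smul_choose,
    ← descPochhammer_eval_eq_prod_range, ← Polynomial.aeval_eq_smeval, Polynomial.aeval_def,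
    Polynomial.eval₂_eq_eval_map, descPochhammer_map]

end Numeric

/-! ### The theorem for hypergraphs -/

namespace UniformHypergraph

open Finset

variable {V : Type*} [Fintype V] {r : ℕ}

theorem mem_nonnegSphere_one_iff {x : V → ℝ} :
    x ∈ nonnegSphere V 1 ↔ (∀ i, 0 ≤ x i) ∧ ∑ i, x i = 1 := by
  refine and_congr_right fun h => ?_
  rw [PiLp.norm_eq_of_L1]
  simp only [Real.norm_eq_abs, abs_of_nonneg (h _)]

theorem isGreatest_lagrangian [Nonempty V] (hr : r ≠ 0) (H : UniformHypergraph V r) :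
    IsGreatest ((fun x : V → ℝ => ∑ e ∈ H.edges, ∏ i ∈ e, x i) ''
      {x | (∀ i, 0 ≤ x i) ∧ ∑ i, x i = 1}) H.lagrangian := by
  have hr0 : (0 : ℝ) < r := by exact_mod_cast Nat.pos_of_ne_zero hr
  obtain ⟨⟨x, hx, hxe⟩, hub⟩ := H.isGreatest_pSpectralRadius 1
  refine ⟨⟨x, mem_nonnegSphere_one_iff.1 hx, ?_⟩, ?_⟩
  · rw [lagrangian, ← hxe, polyForm]
    field_simp
  · rintro _ ⟨y, hy, rfl⟩
    rw [lagrangian, le_div_iff₀ hr0, mul_comm]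
    exact hub ⟨y, mem_nonnegSphere_one_iff.2 hy, rfl⟩

end UniformHypergraph

open Finset UniformHypergraph in
theorem lagrangian_le_and_eq_imp {V : Type*} [Fintype V] [Nonempty V] {r : ℕ} (hr : 2 ≤ r)
    (H : UniformHypergraph V r) (s : ℝ) (hs : (r : ℝ) - 1 < s)
    (hm : (H.edges.card : ℝ) = Ring.choose s r) :
    H.lagrangian ≤ (H.edges.card : ℝ) / s ^ r ∧
      (H.lagrangian = (H.edges.card : ℝ) / s ^ r →
        ∃ k : ℕ, s = (k : ℝ) ∧ H.IsCompleteWithIsolated k) := by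
  classical
  have hr2 : (2 : ℝ) ≤ r := by exact_mod_cast hr
  have hs0 : 0 < s := by linarith
  obtain ⟨x, ⟨hx, hx1⟩, hP⟩ := (H.isGreatest_lagrangian (by omega)).1
  set P := H.lagrangian
  have hD := factorial_mul_ringChoose s r
  rw [← hm] at hD
  have hD0 : 0 < ∏ k ∈ range r, (s - k) := prod_pos fun k hk => by
    have : (k : ℝ) + 1 ≤ r := by exact_mod_cast mem_range.1 hk
    linarith
  have hf : (0 : ℝ) < r.factorial := by positivity
  have hm0 : (0 : ℝ) < H.edges.card := pos_of_mul_pos_right (hD ▸ hD0) hf.le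
  have hB : 0 < (H.edges.card : ℝ) / s ^ r := by positivity
  rcases le_or_gt P 0 with hP0 | hP0
  · exact ⟨hP0.trans hB.le, fun h => absurd h (hP0.trans_lt hB).ne⟩
  obtain ⟨a, ha, hstep, hcard, hent, hsupp⟩ :=
    exists_exp_conditional_entropies hr H.card_of_mem hx hx1 hP hP0
  have hfilter : ((H.edges.filter fun e => ∏ i ∈ e, x i ≠ 0).card : ℝ) ≤ H.edges.card := by
    exact_mod_cast card_filter_le _ _
  have hprod : ∏ k ∈ range r, a k ≤ ∏ k ∈ range r, (s - k) := by
    rw [← hD]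
    exact hcard.trans (by gcongr)
  obtain ⟨hle, heq⟩ := prod_div_pow_le hr ha hstep hs hprod
  have ha0 := ha 0
  have h1 : r.factorial * P ≤ (∏ k ∈ range r, a k) / a 0 ^ r := by
    rwa [le_div_iff₀ (by positivity)]
  rw [← hD] at hle heq
  have h2 : r.factorial * P ≤ r.factorial * (H.edges.card / s ^ r) := by
    rw [← mul_div_assoc]
    exact h1.trans hle
  refine ⟨le_of_mul_le_mul_left h2 hf, fun h => ?_⟩
  rw [h, ← mul_div_assoc] at h1
  have h3 := le_antisymm hle h1
  obtain ⟨has, ha1⟩ := heq h3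
  obtain ⟨S, hS, hsub⟩ := hsupp ha1
  -- Equality gives r! m = ∏ a k, which is at most r! times the number of edges of nonzero weight.
  have h4 : ((H.edges.filter fun e => ∏ i ∈ e, x i ≠ 0).card : ℝ) = H.edges.card := by
    refine le_antisymm hfilter (le_of_mul_le_mul_left ?_ hf)
    rw [has] at h3
    rw [← (div_left_inj' (pow_ne_zero r hs0.ne')).1 h3]
    exact hcard
  have h5 : H.edges.filter (fun e => ∏ i ∈ e, x i ≠ 0) = H.edges :=
    eq_of_subset_of_card_le (filter_subset _ _) (by exact_mod_cast h4.ge)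
  have hsS : s = S.card := by rw [hS, has]
  refine ⟨S.card, hsS, S, rfl, eq_of_subset_of_card_le (fun e he => ?_) ?_⟩
  · rw [← h5] at he
    obtain ⟨he, hne⟩ := mem_filter.1 he
    exact mem_powersetCard.2 ⟨hsub e he hne, H.card_of_mem e he⟩
  · rw [hsS, Ring.choose_natCast] at hm
    rw [card_powersetCard]
    exact_mod_cast hm.ge

open Finset UniformHypergraph in
-- The uniform weight on the k-set attains this value.
theorem le_lagrangian_of_isCompleteWithIsolated {V : Type*} [Fintype V] [Nonempty V] {r : ℕ}
    (hr : r ≠ 0) (H : UniformHypergraph V r) {k : ℕ} (hk : k ≠ 0)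
    (h : H.IsCompleteWithIsolated k) : (H.edges.card : ℝ) / (k : ℝ) ^ r ≤ H.lagrangian := by
  classical
  obtain ⟨S, hS, hE⟩ := h
  have hk0 : (k : ℝ) ≠ 0 := by exact_mod_cast hk
  refine (H.isGreatest_lagrangian hr).2 ⟨fun i => if i ∈ S then (k : ℝ)⁻¹ else 0,
    ⟨fun i => by positivity, by simp [hS, hk0]⟩, ?_⟩
  have h1 : ∀ e ∈ H.edges, ∏ i ∈ e, (if i ∈ S then (k : ℝ)⁻¹ else 0) = ((k : ℝ) ^ r)⁻¹ := by
    intro e he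
    have hes := (mem_powersetCard.1 (hE ▸ he)).1
    rw [prod_congr rfl fun i hi => if_pos (hes hi), prod_const, H.card_of_mem e he, inv_pow]
  simp only
  rw [sum_congr rfl h1, sum_const, nsmul_eq_mul, div_eq_mul_inv]

theorem theorem1 {V : Type*} [Fintype V] [Nonempty V] {r : ℕ} (hr : 2 ≤ r)
    (H : UniformHypergraph V r) (s : ℝ) (hs : (r : ℝ) - 1 ≤ s)
    (hm : (H.edges.card : ℝ) = Ring.choose s r) :
    H.lagrangian ≤ (H.edges.card : ℝ) * s ^ (-(r : ℤ)) ∧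
      (r ≤ Fintype.card V + 1 →
        (H.lagrangian = (H.edges.card : ℝ) * s ^ (-(r : ℤ)) ↔
          ∃ k : ℕ, s = (k : ℝ) ∧ H.IsCompleteWithIsolated k)) := by
  have hr2 : (2 : ℝ) ≤ r := by exact_mod_cast hr
  rw [zpow_neg, zpow_natCast, ← div_eq_mul_inv]
  have hback : (∃ k : ℕ, s = (k : ℝ) ∧ H.IsCompleteWithIsolated k) →
      (H.edges.card : ℝ) / s ^ r ≤ H.lagrangian := by
    rintro ⟨k, rfl, hk⟩
    refine le_lagrangian_of_isCompleteWithIsolated (by omega) H ?_ hk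
    rintro rfl
    rw [Nat.cast_zero] at hs
    linarith
  rcases hs.lt_or_eq with hs | rfl
  · obtain ⟨hle, heq⟩ := lagrangian_le_and_eq_imp hr H s hs hm
    exact ⟨hle, fun _ => ⟨heq, fun h => hle.antisymm (hback h)⟩⟩
  -- The boundary case s = r - 1 has no edges: both sides vanish, and any set of r - 1 vertices is a
  -- witness, which is where |V| ≥ r - 1 is needed.
  · have hcast : (r : ℝ) - 1 = ((r - 1 : ℕ) : ℝ) := by rw [Nat.cast_sub (by omega), Nat.cast_one]
    have h0 : H.edges = ∅ := by
      rw [hcast, Ring.choose_natCast, Nat.choose_eq_zero_of_lt (by omega)] at hm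
      exact Finset.card_eq_zero.1 (by exact_mod_cast hm)
    have hl : H.lagrangian = 0 := by
      obtain ⟨x, -, hx⟩ := (H.isGreatest_lagrangian (by omega)).1
      rw [← hx]
      simp [h0]
    refine ⟨by simp [hl, h0], fun hV => iff_of_true (by simp [hl, h0]) ⟨r - 1, hcast, ?_⟩⟩
    obtain ⟨S, -, hS⟩ := Finset.exists_subset_card_eq (s := (Finset.univ : Finset V)) (n := r - 1)
      (by rw [Finset.card_univ]; omega)
    exact ⟨S, hS, by rw [h0, Finset.powersetCard_eq_empty.2 (by omega)]⟩
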